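/- Let $n\ge 1$ be an integer, let $r>0$, and let $B_r\subset\mathbb R^n$ be the open ball of radius $r$ centered at the origin. Write $du$ for the $\mathbb R^n$-gradient of $u(\cdot,t)$ and $\operatorname{div}$ for the divergence in $\mathbb R^n$. Suppose that the graph of $u:B_r\times[0,r^2]\to\mathbb R$ flows by mean curvature, i.e. $u$ is continuous on $B_r\times[0,r^2]$, smooth on $B_r\times(0,r^2)$, and satisfies there $$u_t=(1+|du|^2)^{1/2}\,\operatorname{div}\left(\frac{du}{(1+|du|^2)^{1/2}}\right).$$ Then $$\log\left(1+|du|^2\left(0,\tfrac{r^2}{4n}\right)\right)\le 2\log 10+16\,n\,\left(1+2\,r^{-1}\,\|u\|_\infty\right)^2,$$ where $\|u\|_\infty=\sup_{B_r\times[0,r^2]}|u|\in[0,\infty]$ (if it is infinite, the right-hand side is $\infty$). -/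

import Mathlib

open Set
open scoped ContDiff ENNReal

namespace GraphMCF

/-- The Euclidean divergence `∑ i, ∂ᵢ Fᵢ` at `x` of a vector field `F` on `ℝⁿ`. -/
noncomputable def euclideanDiv {n : ℕ}
    (F : EuclideanSpace ℝ (Fin n) → EuclideanSpace ℝ (Fin n))
    (x : EuclideanSpace ℝ (Fin n)) : ℝ :=
  ∑ i, (fderiv ℝ F x (EuclideanSpace.single i 1)) i

/-- The volume element `(1 + |df|²)^{1/2}` of the graph of `f`. -/
noncomputable def volumeElement {n : ℕ} (f : EuclideanSpace ℝ (Fin n) → ℝ)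
    (x : EuclideanSpace ℝ (Fin n)) : ℝ :=
  Real.sqrt (1 + ‖gradient f x‖ ^ 2)

/-- The graph of `u : B_r × [0, r²] → ℝ` flows by mean curvature: `u` is continuous on
`B_r × [0, r²]` (with `B_r` the open ball), smooth on the open cylinder `B_r × (0, r²)`, and there
`u_t = (1 + |du|²)^{1/2} div (du / (1 + |du|²)^{1/2})`.
A `u` that is smooth up to the times `0` and `r²` is a special case. Values of `u` outside
`B_r × [0, r²]` play no role. -/
structure GraphFlowsByMeanCurvature {n : ℕ} (r : ℝ)
    (u : EuclideanSpace ℝ (Fin n) → ℝ → ℝ) : Prop where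
  continuousOn : ContinuousOn (fun p : EuclideanSpace ℝ (Fin n) × ℝ => u p.1 p.2)
    (Metric.ball 0 r ×ˢ Icc 0 (r ^ 2))
  contDiffOn : ContDiffOn ℝ ∞ (fun p : EuclideanSpace ℝ (Fin n) × ℝ => u p.1 p.2)
    (Metric.ball 0 r ×ˢ Ioo 0 (r ^ 2))
  equation : ∀ x ∈ Metric.ball (0 : EuclideanSpace ℝ (Fin n)) r, ∀ t ∈ Ioo 0 (r ^ 2),
    deriv (fun s => u x s) t =
      volumeElement (fun z => u z t) x *
        euclideanDiv (fun z => (volumeElement (fun w => u w t) z)⁻¹ •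
          gradient (fun w => u w t) z) x

/-- The sup norm of `u` over `B_r × [0, r²]`, with value `∞` when `u` is unbounded there. -/
noncomputable def supNorm {n : ℕ} (r : ℝ) (u : EuclideanSpace ℝ (Fin n) → ℝ → ℝ) : ℝ≥0∞ :=
  ⨆ x ∈ Metric.ball (0 : EuclideanSpace ℝ (Fin n)) r, ⨆ t ∈ Icc 0 (r ^ 2), ENNReal.ofReal |u x t|

end GraphMCF

/-! The estimate is a maximum principle for `F = η √(1 + |du|²)`, with cutoff `η = exp (K φ) - 1`
and `φ = c t (r² - |x|²) - β + α u`. The constants make `φ` positive at the target point `(0,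
r²/(4n))`, while `φ > 0` keeps the maximum point `z` of `F` off the sides and bottom of a compact
subcylinder. Smoothness is thus needed only in the open cylinder.

Put `p = du(z)` and let `L` be the heat operator with coefficients frozen at `p` (`frozenHeat`). The
evolution of `√(1 + |du|²)` is never computed: by Cauchy-Schwarz `1 + p · du(y) ≤ √(1 + |p|²) √(1 +
|du(y)|²)`, with equality at `y = z`, so `η m` with `m = 1 + ∂ₚu` also has a maximum over the past
at `z`. Differentiating the flow equation in the constant direction `p` gives `(1 + |p|²) L m = -2
|dm|²` at `z`, in the inverse metric of the graph (`frozenHeat_dirDeriv`). Together with `d(η m) =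
0` this cancels the cross term of `L(η m) ≥ 0` exactly, leaving `L η ≥ 0`
(`frozenHeat_cutoff_nonneg`).

For the exponential cutoff, `L η ≥ 0` reads `K |dφ|² ≤ L φ`. As `L u = 0`, the right side is bounded
through the barrier alone, and `dφ = α p - 2 c t x` turns this into a bound for `|p|`
(`gradient_inequality`). Comparing `F` at `z` with `F` at the target point finishes the proof
(`sqrt_areaSq_le`). -/

namespace GraphMCF

/-! ### Directional derivatives and one-dimensional derivative tests. -/

section Calculus

variable {E : Type*} [NormedAddCommGroup E] [NormedSpace ℝ E]

/-- The derivative of `f` at `z` in the direction `w`. -/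
noncomputable def dirDeriv (w : E) (f : E → ℝ) (z : E) : ℝ := fderiv ℝ f z w

variable {Ω : Set E} {f g : E → ℝ} {z : E}

theorem differentiableAt_of_smoothOn (hΩ : IsOpen Ω) (hf : ContDiffOn ℝ ∞ f Ω) (hz : z ∈ Ω) :
    DifferentiableAt ℝ f z :=
  (hf.contDiffAt (hΩ.mem_nhds hz)).differentiableAt (by simp)

theorem contDiffOn_dirDeriv (hΩ : IsOpen Ω) (hf : ContDiffOn ℝ ∞ f Ω) (w : E) :
    ContDiffOn ℝ ∞ (dirDeriv w f) Ω :=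
  (hf.fderiv_of_isOpen hΩ (m := ∞) (by simp)).clm_apply contDiffOn_const

theorem dirDeriv_dirDeriv (hΩ : IsOpen Ω) (hf : ContDiffOn ℝ ∞ f Ω) (hz : z ∈ Ω) (w w' : E) :
    dirDeriv w (dirDeriv w' f) z = fderiv ℝ (fderiv ℝ f) z w w' := by
  have h1 : DifferentiableAt ℝ (fderiv ℝ f) z :=
    ((hf.fderiv_of_isOpen hΩ (m := ∞) (by simp)).contDiffAt (hΩ.mem_nhds hz)).differentiableAt
      (by simp)
  have h2 : HasFDerivAt (fun y => fderiv ℝ f y w')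
      ((fderiv ℝ (fderiv ℝ f) z).flip w') z := by
    simpa using h1.hasFDerivAt.clm_apply (hasFDerivAt_const w' z)
  change fderiv ℝ (fun y => fderiv ℝ f y w') z w = _
  rw [h2.fderiv]
  rfl

theorem dirDeriv_comm (hΩ : IsOpen Ω) (hf : ContDiffOn ℝ ∞ f Ω) (hz : z ∈ Ω) (w w' : E) :
    dirDeriv w (dirDeriv w' f) z = dirDeriv w' (dirDeriv w f) z := by
  rw [dirDeriv_dirDeriv hΩ hf hz, dirDeriv_dirDeriv hΩ hf hz]
  exact ((hf.contDiffAt (hΩ.mem_nhds hz)).isSymmSndFDerivAt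
    (by simpa using WithTop.coe_le_coe.2 (le_top : (2 : ℕ∞) ≤ ⊤))) w w'

theorem dirDeriv_congr (hΩ : IsOpen Ω) (hz : z ∈ Ω) (hfg : EqOn f g Ω) (w : E) :
    dirDeriv w f z = dirDeriv w g z := by
  unfold dirDeriv
  rw [(hfg.eventuallyEq_of_mem (hΩ.mem_nhds hz)).fderiv_eq]

theorem dirDeriv_mul (hf : DifferentiableAt ℝ f z) (hg : DifferentiableAt ℝ g z) (w : E) :
    dirDeriv w (fun y => f y * g y) z = dirDeriv w f z * g z + f z * dirDeriv w g z := by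
  unfold dirDeriv
  rw [fderiv_fun_mul hf hg]
  simp
  ring

theorem dirDeriv_add (hf : DifferentiableAt ℝ f z) (hg : DifferentiableAt ℝ g z) (w : E) :
    dirDeriv w (fun y => f y + g y) z = dirDeriv w f z + dirDeriv w g z := by
  unfold dirDeriv
  rw [fderiv_fun_add hf hg]
  simp

theorem dirDeriv_sub (hf : DifferentiableAt ℝ f z) (hg : DifferentiableAt ℝ g z) (w : E) :
    dirDeriv w (fun y => f y - g y) z = dirDeriv w f z - dirDeriv w g z := by
  unfold dirDeriv
  rw [fderiv_fun_sub hf hg]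
  simp

theorem dirDeriv_sum {ι : Type*} (s : Finset ι) {F : ι → E → ℝ}
    (hF : ∀ i ∈ s, DifferentiableAt ℝ (F i) z) (w : E) :
    dirDeriv w (fun y => ∑ i ∈ s, F i y) z = ∑ i ∈ s, dirDeriv w (F i) z := by
  unfold dirDeriv
  rw [fderiv_fun_sum hF]
  simp

theorem dirDeriv_comp {φ : ℝ → ℝ} {φ' : ℝ} (hφ : HasDerivAt φ φ' (f z))
    (hf : DifferentiableAt ℝ f z) (w : E) :
    dirDeriv w (fun y => φ (f y)) z = φ' * dirDeriv w f z := by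
  unfold dirDeriv
  have := (hφ.comp_hasFDerivAt z hf.hasFDerivAt).fderiv
  simp only [Function.comp_def] at this
  rw [this]
  simp

theorem dirDeriv_const_mul (hf : DifferentiableAt ℝ f z) (c : ℝ) (w : E) :
    dirDeriv w (fun y => c * f y) z = c * dirDeriv w f z := by
  unfold dirDeriv
  rw [fderiv_const_mul hf]
  simp

theorem dirDeriv_dirDeriv_mul (hΩ : IsOpen Ω) (hf : ContDiffOn ℝ ∞ f Ω)
    (hg : ContDiffOn ℝ ∞ g Ω) (hz : z ∈ Ω) (w : E) :
    dirDeriv w (dirDeriv w (fun y => f y * g y)) z =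
      dirDeriv w (dirDeriv w f) z * g z + 2 * (dirDeriv w f z * dirDeriv w g z) +
        f z * dirDeriv w (dirDeriv w g) z := by
  have e : EqOn (dirDeriv w (fun y => f y * g y))
      (fun y => dirDeriv w f y * g y + f y * dirDeriv w g y) Ω := fun y hy =>
    dirDeriv_mul (differentiableAt_of_smoothOn hΩ hf hy)
      (differentiableAt_of_smoothOn hΩ hg hy) w
  have df := differentiableAt_of_smoothOn hΩ hf hz
  have dg := differentiableAt_of_smoothOn hΩ hg hz
  have df' := differentiableAt_of_smoothOn hΩ (contDiffOn_dirDeriv hΩ hf w) hz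
  have dg' := differentiableAt_of_smoothOn hΩ (contDiffOn_dirDeriv hΩ hg w) hz
  rw [dirDeriv_congr hΩ hz e, dirDeriv_add (df'.fun_mul dg) (df.fun_mul dg'), dirDeriv_mul df' dg,
    dirDeriv_mul df dg']
  ring

theorem dirDeriv_dirDeriv_add (hΩ : IsOpen Ω) (hf : ContDiffOn ℝ ∞ f Ω)
    (hg : ContDiffOn ℝ ∞ g Ω) (hz : z ∈ Ω) (w : E) :
    dirDeriv w (dirDeriv w (fun y => f y + g y)) z =
      dirDeriv w (dirDeriv w f) z + dirDeriv w (dirDeriv w g) z := by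
  have e : EqOn (dirDeriv w (fun y => f y + g y))
      (fun y => dirDeriv w f y + dirDeriv w g y) Ω := fun y hy =>
    dirDeriv_add (differentiableAt_of_smoothOn hΩ hf hy)
      (differentiableAt_of_smoothOn hΩ hg hy) w
  rw [dirDeriv_congr hΩ hz e,
    dirDeriv_add (differentiableAt_of_smoothOn hΩ (contDiffOn_dirDeriv hΩ hf w) hz)
      (differentiableAt_of_smoothOn hΩ (contDiffOn_dirDeriv hΩ hg w) hz)]

theorem dirDeriv_exp (hf : DifferentiableAt ℝ f z) (K : ℝ) (w : E) :
    dirDeriv w (fun y => Real.exp (K * f y) - 1) z =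
      K * Real.exp (K * f z) * dirDeriv w f z := by
  have h : HasDerivAt (fun s => Real.exp (K * s) - 1) (K * Real.exp (K * f z)) (f z) := by
    have := (((hasDerivAt_id (f z)).const_mul K).exp).sub_const 1
    simpa [mul_comm] using this
  exact dirDeriv_comp h hf w

theorem dirDeriv_dirDeriv_exp (hΩ : IsOpen Ω) (hf : ContDiffOn ℝ ∞ f Ω) (hz : z ∈ Ω)
    (K : ℝ) (w : E) :
    dirDeriv w (dirDeriv w (fun y => Real.exp (K * f y) - 1)) z =
      K * Real.exp (K * f z) * (dirDeriv w (dirDeriv w f) z + K * dirDeriv w f z ^ 2) := by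
  have e : EqOn (dirDeriv w (fun y => Real.exp (K * f y) - 1))
      (fun y => (K * Real.exp (K * f y)) * dirDeriv w f y) Ω := fun y hy =>
    dirDeriv_exp (differentiableAt_of_smoothOn hΩ hf hy) K w
  have df := differentiableAt_of_smoothOn hΩ hf hz
  have h : HasDerivAt (fun s => K * Real.exp (K * s)) (K * (K * Real.exp (K * f z))) (f z) := by
    have := (((hasDerivAt_id (f z)).const_mul K).exp).const_mul K
    simpa [mul_comm] using this
  rw [dirDeriv_congr hΩ hz e, dirDeriv_mul (by fun_prop)
    (differentiableAt_of_smoothOn hΩ (contDiffOn_dirDeriv hΩ hf w) hz), dirDeriv_comp h df]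
  ring

theorem hasDerivAt_line (hf : DifferentiableAt ℝ f z) (w : E) (s : ℝ) {z₀ : E}
    (hz : z = z₀ + s • w) : HasDerivAt (fun s => f (z₀ + s • w)) (dirDeriv w f z) s := by
  have h1 : HasDerivAt (fun s : ℝ => z₀ + s • w) w s := by
    simpa using ((hasDerivAt_id s).smul_const w).const_add z₀
  subst hz
  exact hf.hasFDerivAt.comp_hasDerivAt s h1

theorem dirDeriv_eq_zero_of_isLocalMax (h : IsLocalMax (fun s : ℝ => f (z + s • w)) 0)
    (hf : DifferentiableAt ℝ f z) : dirDeriv w f z = 0 := by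
  have := h.deriv_eq_zero
  rwa [(hasDerivAt_line hf w 0 (by simp)).deriv] at this

theorem dirDeriv_dirDeriv_nonpos_of_isLocalMax {w : E} (hΩ : IsOpen Ω)
    (hf : ContDiffOn ℝ ∞ f Ω) (hz : z ∈ Ω)
    (h : IsLocalMax (fun s : ℝ => f (z + s • w)) 0) :
    dirDeriv w (dirDeriv w f) z ≤ 0 := by
  by_contra! hpos
  have hc : Continuous fun s : ℝ => z + s • w := by fun_prop
  have hev : ∀ᶠ s in nhds (0 : ℝ), z + s • w ∈ Ω :=
    hc.continuousAt.eventually_mem (hΩ.mem_nhds (by simpa using hz))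
  have hd : deriv (fun s : ℝ => f (z + s • w)) =ᶠ[nhds 0] fun s => dirDeriv w f (z + s • w) := by
    filter_upwards [hev] with s hs
    exact (hasDerivAt_line (differentiableAt_of_smoothOn hΩ hf hs) w s rfl).deriv
  have hdd : deriv (deriv fun s : ℝ => f (z + s • w)) 0 = dirDeriv w (dirDeriv w f) z := by
    rw [hd.deriv_eq]
    exact (hasDerivAt_line (differentiableAt_of_smoothOn hΩ (contDiffOn_dirDeriv hΩ hf w) hz)
      w 0 (by simp)).deriv
  -- A positive second derivative would make the maximum also a local minimum, so `f` would be
  -- constant along the line near `z`.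
  have hmin := isLocalMin_of_deriv_deriv_pos (f := fun s : ℝ => f (z + s • w)) (x₀ := 0)
    (by rwa [hdd]) h.deriv_eq_zero
    (hasDerivAt_line (differentiableAt_of_smoothOn hΩ hf hz) w 0 (by simp)).continuousAt
  have hconst : (fun s : ℝ => f (z + s • w)) =ᶠ[nhds 0] fun _ => f (z + (0 : ℝ) • w) := by
    filter_upwards [h, hmin] with s h1 h2
    exact le_antisymm h1 h2
  have := hconst.deriv.deriv_eq
  rw [hdd] at this
  simp at this
  linarith

/-- One-sided, because the maximum may lie on the final time slice, where only earlier times are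
compared. -/
theorem dirDeriv_nonneg_of_le_backward {w : E} (hf : DifferentiableAt ℝ f z)
    (h : ∀ᶠ s in nhdsWithin (0 : ℝ) (Iic 0), f (z + s • w) ≤ f z) : 0 ≤ dirDeriv w f z := by
  have hd := (hasDerivAt_line hf w 0 (z₀ := z) (by simp)).hasDerivWithinAt (s := Iio 0)
  rw [hasDerivWithinAt_iff_tendsto_slope' (by simp)] at hd
  refine ge_of_tendsto hd ?_
  filter_upwards [h.filter_mono (nhdsWithin_mono _ Iio_subset_Iic_self), self_mem_nhdsWithin]
    with s hs hs0
  rw [slope_def_field]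
  simp only [zero_smul, add_zero, sub_zero]
  exact div_nonneg_of_nonpos (by linarith) (le_of_lt hs0)

end Calculus

/-! ### The flow equation in non-divergence form and its linearisation. -/

section Equation

variable {n : ℕ}

/-- The `i`-th spatial coordinate direction in space-time. -/
noncomputable def spaceDir (i : Fin n) : EuclideanSpace ℝ (Fin n) × ℝ :=
  (EuclideanSpace.single i 1, 0)

/-- The time direction in space-time. -/
def timeDir : EuclideanSpace ℝ (Fin n) × ℝ := (0, 1)

/-- `u` as a function on space-time. -/
def spacetime (u : EuclideanSpace ℝ (Fin n) → ℝ → ℝ) (z : EuclideanSpace ℝ (Fin n) × ℝ) : ℝ :=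
  u z.1 z.2

/-- The heat operator `f_t - ∑ f_ii + f_pp / (1 + |p|²)` of a graph with gradient `p`. -/
noncomputable def frozenHeat (p : EuclideanSpace ℝ (Fin n))
    (f : EuclideanSpace ℝ (Fin n) × ℝ → ℝ) (z : EuclideanSpace ℝ (Fin n) × ℝ) : ℝ :=
  dirDeriv timeDir f z - ∑ i, dirDeriv (spaceDir i) (dirDeriv (spaceDir i) f) z +
    dirDeriv (p, 0) (dirDeriv (p, 0) f) z / (1 + ‖p‖ ^ 2)

theorem sum_smul_spaceDir (p : EuclideanSpace ℝ (Fin n)) :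
    ∑ i, p i • spaceDir i = (p, (0 : ℝ)) := by
  have h := (EuclideanSpace.basisFun (Fin n) ℝ).sum_repr p
  ext j
  · conv_rhs => rw [← h]
    simp [spaceDir, Prod.fst_sum]
  · simp [spaceDir, Prod.snd_sum]

theorem dirDeriv_space (p : EuclideanSpace ℝ (Fin n)) (f : EuclideanSpace ℝ (Fin n) × ℝ → ℝ)
    (z : EuclideanSpace ℝ (Fin n) × ℝ) :
    dirDeriv (p, 0) f z = ∑ i, p i * dirDeriv (spaceDir i) f z := by
  rw [← sum_smul_spaceDir]
  simp [dirDeriv]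

theorem norm_sq_eq_sum (p : EuclideanSpace ℝ (Fin n)) : ‖p‖ ^ 2 = ∑ i, p i ^ 2 := by
  simp [EuclideanSpace.norm_sq_eq]

theorem fderiv_slice {f : EuclideanSpace ℝ (Fin n) × ℝ → ℝ} {x : EuclideanSpace ℝ (Fin n)}
    {t : ℝ} (hf : DifferentiableAt ℝ f (x, t)) (w : EuclideanSpace ℝ (Fin n)) :
    fderiv ℝ (fun y => f (y, t)) x w = dirDeriv (w, 0) f (x, t) := by
  have h1 : HasFDerivAt (fun y : EuclideanSpace ℝ (Fin n) => (y, t))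
      (ContinuousLinearMap.inl ℝ (EuclideanSpace ℝ (Fin n)) ℝ) x := hasFDerivAt_prodMk_left x t
  have h2 : HasFDerivAt (fun y => f (y, t)) _ x := hf.hasFDerivAt.comp x h1
  rw [h2.fderiv]
  simp [dirDeriv]

theorem deriv_slice {f : EuclideanSpace ℝ (Fin n) × ℝ → ℝ} {x : EuclideanSpace ℝ (Fin n)}
    {t : ℝ} (hf : DifferentiableAt ℝ f (x, t)) :
    deriv (fun s => f (x, s)) t = dirDeriv timeDir f (x, t) := by
  have h1 : HasDerivAt (fun s : ℝ => (x, s)) (0, 1) t :=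
    (hasDerivAt_const t x).prodMk (hasDerivAt_id t)
  exact (hf.hasFDerivAt.comp_hasDerivAt t h1).deriv

theorem gradient_coord (f : EuclideanSpace ℝ (Fin n) → ℝ) (x : EuclideanSpace ℝ (Fin n))
    (i : Fin n) : gradient f x i = fderiv ℝ f x (EuclideanSpace.single i 1) := by
  have h : inner ℝ (gradient f x) (EuclideanSpace.single i (1 : ℝ)) =
      fderiv ℝ f x (EuclideanSpace.single i 1) := by
    rw [gradient, InnerProductSpace.toDual_symm_apply]
  rw [← h, EuclideanSpace.inner_single_right]
  simp

theorem gradient_slice_coord {u : EuclideanSpace ℝ (Fin n) → ℝ → ℝ}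
    {x : EuclideanSpace ℝ (Fin n)} {t : ℝ} (h : DifferentiableAt ℝ (spacetime u) (x, t))
    (i : Fin n) :
    gradient (fun y => u y t) x i = dirDeriv (spaceDir i) (spacetime u) (x, t) := by
  rw [gradient_coord]
  exact fderiv_slice h _

theorem euclideanDiv_eq {F : EuclideanSpace ℝ (Fin n) → EuclideanSpace ℝ (Fin n)}
    {G : Fin n → EuclideanSpace ℝ (Fin n) × ℝ → ℝ} {x : EuclideanSpace ℝ (Fin n)} {t : ℝ}
    (hG : ∀ i, DifferentiableAt ℝ (G i) (x, t))
    (h : ∀ᶠ y in nhds x, ∀ i, F y i = G i (y, t)) :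
    euclideanDiv F x = ∑ i, dirDeriv (spaceDir i) (G i) (x, t) := by
  have hFG : ∀ i, (fun y => F y i) =ᶠ[nhds x] fun y => G i (y, t) := fun i => by
    filter_upwards [h] with y hy using hy i
  have hd : ∀ i, DifferentiableAt ℝ (fun y => G i (y, t)) x := fun i =>
    (hG i).comp x (hasFDerivAt_prodMk_left x t).differentiableAt
  have hF : DifferentiableAt ℝ F x :=
    differentiableAt_euclidean.2 fun i => (hd i).congr_of_eventuallyEq (hFG i)
  unfold euclideanDiv
  refine Finset.sum_congr rfl fun i _ => ?_
  have h1 := (EuclideanSpace.proj (𝕜 := ℝ) i).hasFDerivAt.comp x hF.hasFDerivAt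
  have h2 : fderiv ℝ (fun y => F y i) x = _ := h1.fderiv
  rw [(hFG i).fderiv_eq] at h2
  exact (congrArg (fun A => A (EuclideanSpace.single i 1)) h2).symm.trans (fderiv_slice (hG i) _)

/-- The cylinder `B_r × (0, r²)`. -/
def cylinder (n : ℕ) (r : ℝ) : Set (EuclideanSpace ℝ (Fin n) × ℝ) :=
  Metric.ball 0 r ×ˢ Ioo 0 (r ^ 2)

theorem isOpen_cylinder (r : ℝ) : IsOpen (cylinder n r) :=
  Metric.isOpen_ball.prod isOpen_Ioo

/-- The square `1 + |du|²` of the volume element, as a function on space-time. -/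
noncomputable def areaSq (u : EuclideanSpace ℝ (Fin n) → ℝ → ℝ)
    (z : EuclideanSpace ℝ (Fin n) × ℝ) : ℝ :=
  1 + ∑ k, dirDeriv (spaceDir k) (spacetime u) z * dirDeriv (spaceDir k) (spacetime u) z

theorem areaSq_pos (u : EuclideanSpace ℝ (Fin n) → ℝ → ℝ)
    (z : EuclideanSpace ℝ (Fin n) × ℝ) : 0 < areaSq u z := by
  have : 0 ≤ ∑ k, dirDeriv (spaceDir k) (spacetime u) z * dirDeriv (spaceDir k) (spacetime u) z :=
    Finset.sum_nonneg fun k _ => mul_self_nonneg _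
  unfold areaSq
  linarith

theorem areaSq_eq {u : EuclideanSpace ℝ (Fin n) → ℝ → ℝ} {x : EuclideanSpace ℝ (Fin n)} {t : ℝ}
    (h : DifferentiableAt ℝ (spacetime u) (x, t)) :
    1 + ‖gradient (fun y => u y t) x‖ ^ 2 = areaSq u (x, t) := by
  rw [norm_sq_eq_sum, areaSq]
  simp only [gradient_slice_coord h, sq]

theorem dirDeriv_areaSq {r : ℝ} {u : EuclideanSpace ℝ (Fin n) → ℝ → ℝ}
    (hu : ContDiffOn ℝ ∞ (spacetime u) (cylinder n r)) {z : EuclideanSpace ℝ (Fin n) × ℝ}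
    (hz : z ∈ cylinder n r) (w : EuclideanSpace ℝ (Fin n) × ℝ) :
    DifferentiableAt ℝ (areaSq u) z ∧ dirDeriv w (areaSq u) z =
      2 * ∑ k, dirDeriv (spaceDir k) (spacetime u) z *
        dirDeriv w (dirDeriv (spaceDir k) (spacetime u)) z := by
  have hd : ∀ k, DifferentiableAt ℝ (dirDeriv (spaceDir k) (spacetime u)) z := fun k =>
    differentiableAt_of_smoothOn (isOpen_cylinder r)
      (contDiffOn_dirDeriv (isOpen_cylinder r) hu (spaceDir k)) hz
  have hs : DifferentiableAt ℝ (fun z => ∑ k, dirDeriv (spaceDir k) (spacetime u) z *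
      dirDeriv (spaceDir k) (spacetime u) z) z :=
    DifferentiableAt.fun_sum fun k _ => (hd k).fun_mul (hd k)
  refine ⟨hs.const_add 1, ?_⟩
  unfold areaSq
  rw [dirDeriv_add (differentiableAt_const _) hs, dirDeriv_sum _ fun k _ => (hd k).fun_mul (hd k)]
  have : dirDeriv w (fun _ : EuclideanSpace ℝ (Fin n) × ℝ => (1 : ℝ)) z = 0 := by simp [dirDeriv]
  rw [this, zero_add, Finset.mul_sum]
  refine Finset.sum_congr rfl fun k _ => ?_
  rw [dirDeriv_mul (hd k) (hd k)]
  ring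

/-- The mean curvature flow equation in non-divergence form. -/
theorem GraphFlowsByMeanCurvature.nondivergence {r : ℝ}
    {u : EuclideanSpace ℝ (Fin n) → ℝ → ℝ} (hu : GraphFlowsByMeanCurvature r u)
    {z : EuclideanSpace ℝ (Fin n) × ℝ} (hz : z ∈ cylinder n r) :
    areaSq u z * (dirDeriv timeDir (spacetime u) z -
        ∑ i, dirDeriv (spaceDir i) (dirDeriv (spaceDir i) (spacetime u)) z) +
      ∑ i, ∑ j, dirDeriv (spaceDir i) (spacetime u) z * dirDeriv (spaceDir j) (spacetime u) z *
        dirDeriv (spaceDir i) (dirDeriv (spaceDir j) (spacetime u)) z = 0 := by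
  obtain ⟨x, t⟩ := z
  have hΩ := isOpen_cylinder (n := n) r
  have hs : ContDiffOn ℝ ∞ (spacetime u) (cylinder n r) := hu.contDiffOn
  have hdiff : ∀ y ∈ Metric.ball (0 : EuclideanSpace ℝ (Fin n)) r,
      DifferentiableAt ℝ (spacetime u) (y, t) := fun y hy =>
    differentiableAt_of_smoothOn hΩ hs ⟨hy, hz.2⟩
  have hd : ∀ k, DifferentiableAt ℝ (dirDeriv (spaceDir k) (spacetime u)) (x, t) := fun k =>
    differentiableAt_of_smoothOn hΩ (contDiffOn_dirDeriv hΩ hs (spaceDir k)) hz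
  have hW := areaSq_pos u (x, t)
  have hφ : HasDerivAt (fun s => (Real.sqrt s)⁻¹)
      (-(1 / (2 * Real.sqrt (areaSq u (x, t)))) / Real.sqrt (areaSq u (x, t)) ^ 2)
      (areaSq u (x, t)) :=
    (Real.hasDerivAt_sqrt hW.ne').inv (Real.sqrt_pos.2 hW).ne'
  have hA := (dirDeriv_areaSq hs hz 0).1
  have hsd : DifferentiableAt ℝ (fun q => (Real.sqrt (areaSq u q))⁻¹) (x, t) :=
    hφ.differentiableAt.comp (x, t) hA
  have hdiv := euclideanDiv_eq (F := fun y => (volumeElement (fun w => u w t) y)⁻¹ •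
      gradient (fun w => u w t) y) (x := x) (t := t)
    (G := fun i q => (Real.sqrt (areaSq u q))⁻¹ * dirDeriv (spaceDir i) (spacetime u) q)
    (fun i => hsd.fun_mul (hd i))
    (by
      filter_upwards [Metric.isOpen_ball.mem_nhds hz.1] with y hy i
      rw [volumeElement, areaSq_eq (hdiff y hy)]
      simp [gradient_slice_coord (hdiff y hy)])
  have heq := hu.equation x hz.1 t hz.2
  have ht : deriv (fun s => u x s) t = dirDeriv timeDir (spacetime u) (x, t) :=
    deriv_slice (hdiff x hz.1)
  rw [hdiv, ht, volumeElement, areaSq_eq (hdiff x hz.1)] at heq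
  -- With `W = 1 + |du|²`, differentiating `W^(-1/2)` leaves the common factor `W^(-3/2)`.
  have hterm : ∀ i, dirDeriv (spaceDir i) (fun q => (Real.sqrt (areaSq u q))⁻¹ *
      dirDeriv (spaceDir i) (spacetime u) q) (x, t) =
      (Real.sqrt (areaSq u (x, t)))⁻¹ * (areaSq u (x, t))⁻¹ *
      (areaSq u (x, t) * dirDeriv (spaceDir i) (dirDeriv (spaceDir i) (spacetime u)) (x, t) -
      ∑ j, dirDeriv (spaceDir i) (spacetime u) (x, t) *
        dirDeriv (spaceDir j) (spacetime u) (x, t) *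
        dirDeriv (spaceDir i) (dirDeriv (spaceDir j) (spacetime u)) (x, t)) := fun i => by
    rw [dirDeriv_mul hsd (hd i), dirDeriv_comp hφ hA, (dirDeriv_areaSq hs hz _).2,
      Real.sq_sqrt hW.le]
    simp only [mul_assoc]
    rw [← Finset.mul_sum]
    have := (Real.sqrt_pos.2 hW).ne'
    field_simp
    ring
  rw [Finset.sum_congr rfl fun i _ => hterm i, ← Finset.mul_sum, Finset.sum_sub_distrib,
    ← Finset.mul_sum] at heq
  rw [heq]
  have := (Real.sqrt_pos.2 hW).ne'
  field_simp
  ring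

/-- The linearised equation for the derivative of `u` in the direction of its gradient `p` at
a point. -/
theorem GraphFlowsByMeanCurvature.frozenHeat_dirDeriv {r : ℝ}
    {u : EuclideanSpace ℝ (Fin n) → ℝ → ℝ} (hu : GraphFlowsByMeanCurvature r u)
    {z : EuclideanSpace ℝ (Fin n) × ℝ} (hz : z ∈ cylinder n r)
    {p : EuclideanSpace ℝ (Fin n)} (hp : ∀ i, p i = dirDeriv (spaceDir i) (spacetime u) z) :
    (1 + ‖p‖ ^ 2) * frozenHeat p (dirDeriv (p, 0) (spacetime u)) z =
      2 * (dirDeriv (p, 0) (dirDeriv (p, 0) (spacetime u)) z ^ 2 / (1 + ‖p‖ ^ 2) -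
        ∑ i, dirDeriv (spaceDir i) (dirDeriv (p, 0) (spacetime u)) z ^ 2) := by
  have hΩ := isOpen_cylinder (n := n) r
  have hs : ContDiffOn ℝ ∞ (spacetime u) (cylinder n r) := hu.contDiffOn
  set U := spacetime u with hU
  have s1 : ∀ w, ContDiffOn ℝ ∞ (dirDeriv w U) (cylinder n r) := contDiffOn_dirDeriv hΩ hs
  have s2 : ∀ w w', ContDiffOn ℝ ∞ (dirDeriv w (dirDeriv w' U)) (cylinder n r) := fun w w' =>
    contDiffOn_dirDeriv hΩ (s1 w') w
  have d1 : ∀ w, DifferentiableAt ℝ (dirDeriv w U) z := fun w =>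
    differentiableAt_of_smoothOn hΩ (s1 w) hz
  have d2 : ∀ w w', DifferentiableAt ℝ (dirDeriv w (dirDeriv w' U)) z := fun w w' =>
    differentiableAt_of_smoothOn hΩ (s2 w w') hz
  have hW : areaSq u z = 1 + ‖p‖ ^ 2 := by
    rw [norm_sq_eq_sum, areaSq]
    simp only [hp, sq]
    rfl
  have hWpos : 0 < 1 + ‖p‖ ^ 2 := by positivity
  obtain ⟨hWd, hWe⟩ := dirDeriv_areaSq hs hz (p, 0)
  set e : EuclideanSpace ℝ (Fin n) × ℝ := (p, 0) with he
  -- the third derivatives, with the direction `e` moved inside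
  have c1 : ∀ w w', dirDeriv w (dirDeriv w' U) z = dirDeriv w' (dirDeriv w U) z :=
    fun w w' => dirDeriv_comm hΩ hs hz w w'
  have c2 : ∀ w w', dirDeriv e (dirDeriv w (dirDeriv w' U)) z =
      dirDeriv w (dirDeriv w' (dirDeriv e U)) z := fun w w' => by
    rw [dirDeriv_comm hΩ (s1 w') hz e w]
    exact dirDeriv_congr hΩ hz (fun y hy => dirDeriv_comm hΩ hs hy e w') w
  set q : Fin n → ℝ := fun i => dirDeriv (spaceDir i) (dirDeriv e U) z with hq
  have hpq : dirDeriv e (dirDeriv e U) z = ∑ i, p i * q i := dirDeriv_space p _ z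
  have hqi : ∀ i, q i = ∑ j, p j * dirDeriv (spaceDir i) (dirDeriv (spaceDir j) U) z := fun i => by
    rw [hq]
    change dirDeriv (spaceDir i) (dirDeriv e U) z = _
    rw [c1, dirDeriv_space]
    exact Finset.sum_congr rfl fun j _ => by rw [c1]
  -- the second derivatives in the direction `e` in coordinates
  have hee : dirDeriv e (dirDeriv e (dirDeriv e U)) z =
      ∑ i, ∑ j, p i * p j * dirDeriv (spaceDir i) (dirDeriv (spaceDir j) (dirDeriv e U)) z := by
    rw [he, dirDeriv_space]
    refine Finset.sum_congr rfl fun i _ => ?_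
    rw [← he, dirDeriv_comm hΩ (s1 e) hz, he, dirDeriv_space, Finset.mul_sum]
    refine Finset.sum_congr rfl fun j _ => ?_
    rw [← he, dirDeriv_comm hΩ (s1 e) hz]
    ring
  -- The equation holds on an open set and `e` is a constant direction, so its `e`-derivative
  -- vanishes at `z`.
  have hz0 : dirDeriv e (fun z => areaSq u z * (dirDeriv timeDir U z -
        ∑ i, dirDeriv (spaceDir i) (dirDeriv (spaceDir i) U) z) +
      ∑ i, ∑ j, dirDeriv (spaceDir i) U z * dirDeriv (spaceDir j) U z *
        dirDeriv (spaceDir i) (dirDeriv (spaceDir j) U) z) z = 0 := by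
    rw [dirDeriv_congr (g := fun _ => 0) hΩ hz fun y hy => hu.nondivergence hy]
    simp [dirDeriv]
  have h0 := hu.nondivergence hz
  rw [← hU] at h0
  have dsum : DifferentiableAt ℝ
      (fun z => ∑ i, dirDeriv (spaceDir i) (dirDeriv (spaceDir i) U) z) z :=
    DifferentiableAt.fun_sum fun i _ => d2 _ _
  have dterm : ∀ i j, DifferentiableAt ℝ (fun z => dirDeriv (spaceDir i) U z *
      dirDeriv (spaceDir j) U z * dirDeriv (spaceDir i) (dirDeriv (spaceDir j) U) z) z :=
    fun i j => ((d1 _).fun_mul (d1 _)).fun_mul (d2 _ _)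
  have dinner : ∀ i, DifferentiableAt ℝ (fun z => ∑ j, dirDeriv (spaceDir i) U z *
      dirDeriv (spaceDir j) U z * dirDeriv (spaceDir i) (dirDeriv (spaceDir j) U) z) z :=
    fun i => DifferentiableAt.fun_sum fun j _ => dterm i j
  have htq : ∀ i j, dirDeriv e (fun z => dirDeriv (spaceDir i) U z *
      dirDeriv (spaceDir j) U z * dirDeriv (spaceDir i) (dirDeriv (spaceDir j) U) z) z =
      q i * (p j * dirDeriv (spaceDir i) (dirDeriv (spaceDir j) U) z) +
      q j * (p i * dirDeriv (spaceDir j) (dirDeriv (spaceDir i) U) z) +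
      p i * p j * dirDeriv (spaceDir i) (dirDeriv (spaceDir j) (dirDeriv e U)) z := fun i j => by
    rw [dirDeriv_mul ((d1 _).fun_mul (d1 _)) (d2 _ _), dirDeriv_mul (d1 _) (d1 _), c2,
      c1 e (spaceDir i), c1 e (spaceDir j), c1 (spaceDir j) (spaceDir i), hp i, hp j]
    simp only [hq]
    ring
  rw [dirDeriv_add (hWd.fun_mul ((d1 _).fun_sub dsum))
      (DifferentiableAt.fun_sum fun i _ => dinner i),
    dirDeriv_mul hWd ((d1 _).fun_sub dsum), dirDeriv_sub (d1 _) dsum,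
    dirDeriv_sum _ fun i _ => d2 _ _, dirDeriv_sum _ fun i _ => dinner i,
    Finset.sum_congr rfl fun i _ => dirDeriv_sum _ (fun j _ => dterm i j) e] at hz0
  simp only [htq, Finset.sum_add_distrib, c2, ← hee] at hz0
  have hq1 : ∑ i, ∑ j, q i * (p j * dirDeriv (spaceDir i) (dirDeriv (spaceDir j) U) z) =
      ∑ i, q i ^ 2 := Finset.sum_congr rfl fun i _ => by rw [← Finset.mul_sum, ← hqi, sq]
  have hq2 : ∑ i, ∑ j, q j * (p i * dirDeriv (spaceDir j) (dirDeriv (spaceDir i) U) z) =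
      ∑ i, q i ^ 2 := by rw [Finset.sum_comm, hq1]
  have hpp : ∑ i, ∑ j, dirDeriv (spaceDir i) U z * dirDeriv (spaceDir j) U z *
      dirDeriv (spaceDir i) (dirDeriv (spaceDir j) U) z = ∑ i, p i * q i := by
    refine Finset.sum_congr rfl fun i _ => ?_
    rw [hqi, Finset.mul_sum]
    refine Finset.sum_congr rfl fun j _ => ?_
    rw [hp i, hp j]
    ring
  have hWe' : dirDeriv e (areaSq u) z = 2 * ∑ i, p i * q i := by
    rw [hWe]
    congr 1
    refine Finset.sum_congr rfl fun i _ => ?_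
    rw [hp i, c1 e]
  rw [hq1, hq2, hWe', hW, c1 e timeDir] at hz0
  rw [hpp, hW] at h0
  -- The equation itself replaces `u_t - Δu`; multiplied by the `e`-derivative of `1 + |du|²`, it
  -- yields the term in `u_pp²`.
  have h0' : dirDeriv timeDir U z - ∑ i, dirDeriv (spaceDir i) (dirDeriv (spaceDir i) U) z =
      -(∑ i, p i * q i) / (1 + ‖p‖ ^ 2) := by
    field_simp
    linarith
  rw [h0'] at hz0
  rw [frozenHeat, hpq, ← he]
  change _ = 2 * (_ - ∑ i, q i ^ 2)
  field_simp at hz0 ⊢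
  linarith

end Equation

/-! ### The frozen heat operator at a maximum over the past. -/

section MaximumPrinciple

variable {n : ℕ} {Ω : Set (EuclideanSpace ℝ (Fin n) × ℝ)}
  {f g : EuclideanSpace ℝ (Fin n) × ℝ → ℝ} {z : EuclideanSpace ℝ (Fin n) × ℝ}

/-- The correction term pairs `df` and `dg` in `I - p ⊗ p / (1 + |p|²)`, the inverse of the graph
metric `I + p ⊗ p`. -/
theorem frozenHeat_mul (hΩ : IsOpen Ω) (hf : ContDiffOn ℝ ∞ f Ω) (hg : ContDiffOn ℝ ∞ g Ω)
    (hz : z ∈ Ω) (p : EuclideanSpace ℝ (Fin n)) :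
    frozenHeat p (fun y => f y * g y) z = frozenHeat p f z * g z + f z * frozenHeat p g z -
      2 * (∑ i, dirDeriv (spaceDir i) f z * dirDeriv (spaceDir i) g z -
        dirDeriv (p, 0) f z * dirDeriv (p, 0) g z / (1 + ‖p‖ ^ 2)) := by
  unfold frozenHeat
  rw [dirDeriv_mul (differentiableAt_of_smoothOn hΩ hf hz) (differentiableAt_of_smoothOn hΩ hg hz),
    dirDeriv_dirDeriv_mul hΩ hf hg hz]
  simp only [dirDeriv_dirDeriv_mul hΩ hf hg hz, Finset.sum_add_distrib, ← Finset.sum_mul,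
    ← Finset.mul_sum]
  ring

theorem frozenHeat_add (hΩ : IsOpen Ω) (hf : ContDiffOn ℝ ∞ f Ω) (hg : ContDiffOn ℝ ∞ g Ω)
    (hz : z ∈ Ω) (p : EuclideanSpace ℝ (Fin n)) :
    frozenHeat p (fun y => f y + g y) z = frozenHeat p f z + frozenHeat p g z := by
  unfold frozenHeat
  rw [dirDeriv_add (differentiableAt_of_smoothOn hΩ hf hz) (differentiableAt_of_smoothOn hΩ hg hz),
    dirDeriv_dirDeriv_add hΩ hf hg hz]
  simp only [dirDeriv_dirDeriv_add hΩ hf hg hz, Finset.sum_add_distrib]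
  ring

theorem frozenHeat_const (c : ℝ) (p : EuclideanSpace ℝ (Fin n)) :
    frozenHeat p (fun _ => c) z = 0 := by
  have h : ∀ (w : EuclideanSpace ℝ (Fin n) × ℝ) (c : ℝ), dirDeriv w (fun _ => c) = fun _ => 0 :=
    fun w c => by ext; simp [dirDeriv]
  simp [frozenHeat, h]

theorem frozenHeat_exp (hΩ : IsOpen Ω) (hf : ContDiffOn ℝ ∞ f Ω) (hz : z ∈ Ω) (K : ℝ)
    (p : EuclideanSpace ℝ (Fin n)) :
    frozenHeat p (fun y => Real.exp (K * f y) - 1) z = K * Real.exp (K * f z) *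
      (frozenHeat p f z - K * (∑ i, dirDeriv (spaceDir i) f z ^ 2 -
        dirDeriv (p, 0) f z ^ 2 / (1 + ‖p‖ ^ 2))) := by
  unfold frozenHeat
  rw [dirDeriv_exp (differentiableAt_of_smoothOn hΩ hf hz), dirDeriv_dirDeriv_exp hΩ hf hz]
  simp only [dirDeriv_dirDeriv_exp hΩ hf hz, ← Finset.mul_sum, Finset.sum_add_distrib]
  ring

/-- Ellipticity of the symbol `I - p ⊗ p / (1 + |p|²)`. -/
theorem sum_sub_div_nonpos (p : EuclideanSpace ℝ (Fin n))
    (B : EuclideanSpace ℝ (Fin n) × ℝ →L[ℝ] EuclideanSpace ℝ (Fin n) × ℝ →L[ℝ] ℝ)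
    (hB : ∀ w : EuclideanSpace ℝ (Fin n), B (w, 0) (w, 0) ≤ 0) :
    ∑ i, B (spaceDir i) (spaceDir i) - B (p, 0) (p, 0) / (1 + ‖p‖ ^ 2) ≤ 0 := by
  set v := Real.sqrt (1 + ‖p‖ ^ 2) with hv
  have hv2 : v ^ 2 = 1 + ‖p‖ ^ 2 := Real.sq_sqrt (by positivity)
  have hvpos : 0 < v := Real.sqrt_pos.2 (by positivity)
  -- `I - c p ⊗ p` is the square root of the symbol, since `2c - c²|p|² = 1 / (1 + |p|²)`. The
  -- contraction of `B` with the symbol is then a sum of values of `B` on the diagonal.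
  set c := 1 / (v * (v + 1)) with hc
  have hk : ∀ k, B (spaceDir k - (c * p k) • (p, (0 : ℝ))) (spaceDir k - (c * p k) • (p, (0 : ℝ)))
      ≤ 0 := fun k => by
    convert hB (EuclideanSpace.single k 1 - (c * p k) • p) using 2 <;> simp [spaceDir]
  have h1 : ∑ k, p k * B (spaceDir k) (p, 0) = B (p, 0) (p, 0) := by
    conv_rhs => enter [1, 2]; rw [← sum_smul_spaceDir p]
    simp
  have h2 : ∑ k, p k * B (p, 0) (spaceDir k) = B (p, 0) (p, 0) := by
    conv_rhs => enter [2]; rw [← sum_smul_spaceDir p]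
    simp
  have hsum := Finset.sum_nonpos fun k (_ : k ∈ Finset.univ) => hk k
  have hexp : ∀ k, B (spaceDir k - (c * p k) • (p, (0 : ℝ)))
      (spaceDir k - (c * p k) • (p, (0 : ℝ))) = B (spaceDir k) (spaceDir k) -
      c * (p k * B (spaceDir k) (p, 0)) - c * (p k * B (p, 0) (spaceDir k)) +
      c ^ 2 * B (p, 0) (p, 0) * p k ^ 2 := fun k => by
    simp only [map_sub, map_smul, _root_.sub_apply, _root_.smul_apply,
      smul_eq_mul]
    ring
  simp only [hexp, Finset.sum_add_distrib, Finset.sum_sub_distrib, ← Finset.mul_sum, h1, h2,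
    ← norm_sq_eq_sum] at hsum
  have hp2 : ‖p‖ ^ 2 = v ^ 2 - 1 := by linarith
  have hcc : 2 * c - c ^ 2 * ‖p‖ ^ 2 = 1 / (1 + ‖p‖ ^ 2) := by
    rw [← hv2, hp2, hc]
    field_simp
    ring
  have : B (p, 0) (p, 0) / (1 + ‖p‖ ^ 2) =
      (2 * c - c ^ 2 * ‖p‖ ^ 2) * B (p, 0) (p, 0) := by rw [hcc]; ring
  rw [this]
  linarith

/-- At a maximum over the past the heat operator is nonnegative. -/
theorem frozenHeat_nonneg_of_max (hΩ : IsOpen Ω) (hf : ContDiffOn ℝ ∞ f Ω) (hz : z ∈ Ω)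
    (h : ∀ᶠ y in nhds z, y.2 ≤ z.2 → f y ≤ f z) (p : EuclideanSpace ℝ (Fin n)) :
    0 ≤ frozenHeat p f z ∧ ∀ w : EuclideanSpace ℝ (Fin n), dirDeriv (w, 0) f z = 0 := by
  have hd := differentiableAt_of_smoothOn hΩ hf hz
  have hline : ∀ w : EuclideanSpace ℝ (Fin n) × ℝ, ∀ᶠ s in nhds (0 : ℝ),
      (z + s • w).2 ≤ z.2 → f (z + s • w) ≤ f z := fun w => by
    have hc : Continuous fun s : ℝ => z + s • w := by fun_prop
    have := hc.tendsto 0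
    simp only [zero_smul, add_zero] at this
    exact this.eventually h
  have hmax : ∀ w : EuclideanSpace ℝ (Fin n),
      IsLocalMax (fun s : ℝ => f (z + s • (w, (0 : ℝ)))) 0 := fun w => by
    filter_upwards [hline (w, 0)] with s hs
    simpa using hs (by simp)
  have ht : 0 ≤ dirDeriv timeDir f z := dirDeriv_nonneg_of_le_backward hd (by
    filter_upwards [nhdsWithin_le_nhds (hline timeDir), self_mem_nhdsWithin] with s hs hs0
    exact hs (by simpa [timeDir] using hs0))
  refine ⟨?_, fun w => dirDeriv_eq_zero_of_isLocalMax (hmax w) hd⟩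
  have hell := sum_sub_div_nonpos p (fderiv ℝ (fderiv ℝ f) z) fun w => by
    rw [← dirDeriv_dirDeriv hΩ hf hz]
    exact dirDeriv_dirDeriv_nonpos_of_isLocalMax hΩ hf hz (hmax w)
  simp only [← dirDeriv_dirDeriv hΩ hf hz] at hell
  unfold frozenHeat
  linarith

/-- Consequently, adding a multiple of `u` to a barrier changes its gradient but not its image under
the operator. -/
theorem GraphFlowsByMeanCurvature.frozenHeat_self {r : ℝ}
    {u : EuclideanSpace ℝ (Fin n) → ℝ → ℝ} (hu : GraphFlowsByMeanCurvature r u)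
    (hz : z ∈ cylinder n r) {p : EuclideanSpace ℝ (Fin n)}
    (hp : ∀ i, p i = dirDeriv (spaceDir i) (spacetime u) z) :
    frozenHeat p (spacetime u) z = 0 := by
  have hΩ := isOpen_cylinder (n := n) r
  have hs : ContDiffOn ℝ ∞ (spacetime u) (cylinder n r) := hu.contDiffOn
  have h := hu.nondivergence hz
  have hW : areaSq u z = 1 + ‖p‖ ^ 2 := by
    rw [norm_sq_eq_sum, areaSq]
    simp only [hp, sq]
  have hpp : dirDeriv (p, 0) (dirDeriv (p, 0) (spacetime u)) z =
      ∑ i, ∑ j, dirDeriv (spaceDir i) (spacetime u) z * dirDeriv (spaceDir j) (spacetime u) z *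
        dirDeriv (spaceDir i) (dirDeriv (spaceDir j) (spacetime u)) z := by
    rw [dirDeriv_space]
    refine Finset.sum_congr rfl fun i _ => ?_
    rw [dirDeriv_comm hΩ hs hz, dirDeriv_space, Finset.mul_sum]
    refine Finset.sum_congr rfl fun j _ => ?_
    rw [dirDeriv_comm hΩ hs hz, hp i, hp j]
    ring
  have hpos : 0 < 1 + ‖p‖ ^ 2 := by positivity
  rw [← hpp, hW] at h
  unfold frozenHeat
  field_simp
  linarith

/-- If `η √(1 + |du|²)` has a positive maximum over the past, then `η` is a subsolution there of
the heat equation on the graph. -/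
theorem GraphFlowsByMeanCurvature.frozenHeat_cutoff_nonneg {r : ℝ}
    {u : EuclideanSpace ℝ (Fin n) → ℝ → ℝ} (hu : GraphFlowsByMeanCurvature r u)
    (hz : z ∈ cylinder n r) {p : EuclideanSpace ℝ (Fin n)}
    (hp : ∀ i, p i = dirDeriv (spaceDir i) (spacetime u) z)
    {η : EuclideanSpace ℝ (Fin n) × ℝ → ℝ} (hη : ContDiffOn ℝ ∞ η (cylinder n r))
    (hpos : 0 < η z)
    (hmax : ∀ᶠ y in nhds z, y.2 ≤ z.2 →
      η y * Real.sqrt (areaSq u y) ≤ η z * Real.sqrt (areaSq u z)) :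
    0 ≤ frozenHeat p η z := by
  have hΩ := isOpen_cylinder (n := n) r
  have hs : ContDiffOn ℝ ∞ (spacetime u) (cylinder n r) := hu.contDiffOn
  have hm0 := contDiffOn_dirDeriv hΩ hs (p, 0)
  -- The linear substitute for `√(1 + |p|²) √(1 + |du|²)`: it is the inner product of `(1, p)` and
  -- `(1, du)`, hence bounded by that product, with equality at `z`.
  set m : EuclideanSpace ℝ (Fin n) × ℝ → ℝ := fun y => 1 + dirDeriv (p, 0) (spacetime u) y with hm
  have hms : ContDiffOn ℝ ∞ m (cylinder n r) := contDiffOn_const.add hm0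
  have hW : areaSq u z = 1 + ‖p‖ ^ 2 := by
    rw [norm_sq_eq_sum, areaSq]
    simp only [hp, sq]
  have hWpos : 0 < 1 + ‖p‖ ^ 2 := by positivity
  have hmz : m z = 1 + ‖p‖ ^ 2 := by
    rw [norm_sq_eq_sum, hm]
    simp only [dirDeriv_space, ← hp, sq]
  have hmle : ∀ y, m y ≤ Real.sqrt (areaSq u z) * Real.sqrt (areaSq u y) := fun y => by
    rw [← Real.sqrt_mul (areaSq_pos u z).le]
    refine Real.le_sqrt_of_sq_le ?_
    have hcs := Finset.sum_mul_sq_le_sq_mul_sq Finset.univ (fun i => p i)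
      fun i => dirDeriv (spaceDir i) (spacetime u) y
    rw [← dirDeriv_space, ← norm_sq_eq_sum] at hcs
    rw [hW, hm, areaSq]
    simp only [← sq]
    set b := ∑ i, dirDeriv (spaceDir i) (spacetime u) y ^ 2
    have hb : 0 ≤ b := Finset.sum_nonneg fun i _ => sq_nonneg _
    set s := dirDeriv (p, 0) (spacetime u) y
    nlinarith [sq_nonneg (‖p‖ ^ 2 - b), sq_nonneg (‖p‖ ^ 2 + b - 2 * s),
      abs_le_of_sq_le_sq (show (2 * s) ^ 2 ≤ (‖p‖ ^ 2 + b) ^ 2 by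
        nlinarith [sq_nonneg (‖p‖ ^ 2 - b)]) (by positivity)]
  have hηpos : ∀ᶠ y in nhds z, 0 < η y :=
    (hη.continuousOn.continuousAt (hΩ.mem_nhds hz)).eventually_const_lt hpos
  have hh : ∀ᶠ y in nhds z, y.2 ≤ z.2 → η y * m y ≤ η z * m z := by
    filter_upwards [hmax, hηpos] with y hy hηy ht
    calc η y * m y ≤ η y * (Real.sqrt (areaSq u z) * Real.sqrt (areaSq u y)) :=
          mul_le_mul_of_nonneg_left (hmle y) hηy.le
      _ = Real.sqrt (areaSq u z) * (η y * Real.sqrt (areaSq u y)) := by ring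
      _ ≤ Real.sqrt (areaSq u z) * (η z * Real.sqrt (areaSq u z)) :=
          mul_le_mul_of_nonneg_left (hy ht) (Real.sqrt_nonneg _)
      _ = η z * (Real.sqrt (areaSq u z) * Real.sqrt (areaSq u z)) := by ring
      _ = η z * m z := by rw [Real.mul_self_sqrt (areaSq_pos u z).le, hW, hmz]
  obtain ⟨hL, hgrad⟩ := frozenHeat_nonneg_of_max hΩ (hη.mul hms) hz hh p
  have hdm : ∀ w, dirDeriv w m z = dirDeriv w (dirDeriv (p, 0) (spacetime u)) z := fun w => by
    rw [hm, dirDeriv_add (differentiableAt_const _) (differentiableAt_of_smoothOn hΩ hm0 hz)]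
    simp [dirDeriv]
  have hLm := hu.frozenHeat_dirDeriv hz hp
  have hLm' : frozenHeat p m z = frozenHeat p (dirDeriv (p, 0) (spacetime u)) z := by
    rw [hm, frozenHeat_add hΩ contDiffOn_const hm0 hz, frozenHeat_const, zero_add]
  simp only [← hdm, ← hLm'] at hLm
  have hdη : ∀ w : EuclideanSpace ℝ (Fin n),
      dirDeriv (w, 0) η z = -(η z / (1 + ‖p‖ ^ 2)) * dirDeriv (w, 0) m z := fun w => by
    have := hgrad w
    rw [dirDeriv_mul (differentiableAt_of_smoothOn hΩ hη hz)
      (differentiableAt_of_smoothOn hΩ hms hz), hmz] at this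
    field_simp
    linarith
  rw [frozenHeat_mul hΩ hη hms hz, hdη p, hmz] at hL
  have hsum : ∑ i, dirDeriv (spaceDir i) η z * dirDeriv (spaceDir i) m z =
      -(η z / (1 + ‖p‖ ^ 2)) * ∑ i, dirDeriv (spaceDir i) m z ^ 2 := by
    rw [Finset.mul_sum]
    refine Finset.sum_congr rfl fun i _ => ?_
    rw [show dirDeriv (spaceDir i) η z = _ from hdη (EuclideanSpace.single i 1)]
    change _ * dirDeriv (spaceDir i) m z * _ = _
    ring
  rw [hsum] at hL
  have hLm2 : frozenHeat p m z = 2 * (dirDeriv (p, 0) m z ^ 2 / (1 + ‖p‖ ^ 2) -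
      ∑ i, dirDeriv (spaceDir i) m z ^ 2) / (1 + ‖p‖ ^ 2) := by
    rw [← hLm]
    field_simp
  rw [hLm2] at hL
  -- After substituting `dη = -η dm / (1 + |p|²)`, the cross term and `η L m` are opposite.
  have : 0 ≤ frozenHeat p η z * (1 + ‖p‖ ^ 2) := by
    refine hL.trans_eq ?_
    field_simp
    ring
  exact nonneg_of_mul_nonneg_left this hWpos

end MaximumPrinciple

/-! ### The barrier and the resulting gradient inequality. -/

section Barrier

variable {n : ℕ}

/-- The cutoff function `c t (r² - |x|²) - β`. -/
noncomputable def barrier (n : ℕ) (c r β : ℝ) (z : EuclideanSpace ℝ (Fin n) × ℝ) : ℝ :=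
  c * z.2 * (r ^ 2 - ‖z.1‖ ^ 2) - β

theorem contDiff_barrier (c r β : ℝ) : ContDiff ℝ ∞ (barrier n c r β) := by
  unfold barrier
  exact ((contDiff_const.mul contDiff_snd).mul (contDiff_const.sub (contDiff_fst.norm_sq ℝ))).sub
    contDiff_const

theorem dirDeriv_eq_of_line {E : Type*} [NormedAddCommGroup E] [NormedSpace ℝ E] {f : E → ℝ}
    {z w : E} {d : ℝ} (hf : DifferentiableAt ℝ f z)
    (h : HasDerivAt (fun s : ℝ => f (z + s • w)) d 0) : dirDeriv w f z = d :=
  (hasDerivAt_line hf w 0 (by simp)).unique h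

theorem dirDeriv_time_barrier (c r β : ℝ) (z : EuclideanSpace ℝ (Fin n) × ℝ) :
    dirDeriv timeDir (barrier n c r β) z = c * (r ^ 2 - ‖z.1‖ ^ 2) := by
  refine dirDeriv_eq_of_line ((contDiff_barrier c r β).differentiable (by simp) z) ?_
  have : HasDerivAt (fun s : ℝ => c * (z.2 + s) * (r ^ 2 - ‖z.1‖ ^ 2) - β)
      (c * 1 * (r ^ 2 - ‖z.1‖ ^ 2)) 0 :=
    ((((hasDerivAt_id (0 : ℝ)).const_add z.2).const_mul c).mul_const _).sub_const β
  simpa [barrier, timeDir] using this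

theorem dirDeriv_space_barrier (c r β : ℝ) (w : EuclideanSpace ℝ (Fin n))
    (z : EuclideanSpace ℝ (Fin n) × ℝ) :
    dirDeriv (w, 0) (barrier n c r β) z = -2 * c * z.2 * inner ℝ z.1 w := by
  refine dirDeriv_eq_of_line ((contDiff_barrier c r β).differentiable (by simp) z) ?_
  have h1 : HasDerivAt (fun s : ℝ => z.1 + s • w) w 0 := by
    simpa using ((hasDerivAt_id (0 : ℝ)).smul_const w).const_add z.1
  have := ((h1.norm_sq.const_sub (r ^ 2)).const_mul (c * z.2)).sub_const β
  have e : c * z.2 * -(2 * inner ℝ (z.1 + (0 : ℝ) • w) w) = -2 * c * z.2 * inner ℝ z.1 w := by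
    rw [zero_smul, add_zero]
    ring
  rw [e] at this
  simpa [barrier] using this

theorem dirDeriv_dirDeriv_space_barrier (c r β : ℝ) (w : EuclideanSpace ℝ (Fin n))
    (z : EuclideanSpace ℝ (Fin n) × ℝ) :
    dirDeriv (w, 0) (dirDeriv (w, 0) (barrier n c r β)) z = -2 * c * z.2 * ‖w‖ ^ 2 := by
  have e : dirDeriv (w, 0) (barrier n c r β) =
      fun z => -2 * c * z.2 * inner ℝ z.1 w := funext (dirDeriv_space_barrier c r β w)
  rw [e]
  refine dirDeriv_eq_of_line
    (((differentiableAt_const (-2 * c)).fun_mul differentiableAt_snd).fun_mul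
      (differentiableAt_fst.inner ℝ (differentiableAt_const w))) ?_
  have : HasDerivAt (fun s : ℝ => -2 * c * z.2 * (inner ℝ z.1 w + s * ‖w‖ ^ 2))
      (-2 * c * z.2 * (1 * ‖w‖ ^ 2)) 0 :=
    (((hasDerivAt_id (0 : ℝ)).mul_const _).const_add _).const_mul _
  simpa [inner_add_left, inner_smul_left] using this

theorem frozenHeat_barrier (c r β : ℝ) (p : EuclideanSpace ℝ (Fin n))
    (z : EuclideanSpace ℝ (Fin n) × ℝ) :
    frozenHeat p (barrier n c r β) z = c * (r ^ 2 - ‖z.1‖ ^ 2) + 2 * c * z.2 * n -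
      2 * c * z.2 * (‖p‖ ^ 2 / (1 + ‖p‖ ^ 2)) := by
  have h : ∀ i : Fin n, dirDeriv (spaceDir i) (dirDeriv (spaceDir i) (barrier n c r β)) z =
      -2 * c * z.2 := fun i => by
    have := dirDeriv_dirDeriv_space_barrier c r β (EuclideanSpace.single i 1) z
    rwa [show ‖EuclideanSpace.single i (1 : ℝ)‖ = 1 by simp, one_pow, mul_one] at this
  unfold frozenHeat
  rw [dirDeriv_time_barrier, dirDeriv_dirDeriv_space_barrier]
  simp only [h, Finset.sum_const, Finset.card_univ, Fintype.card_fin, nsmul_eq_mul]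
  ring

/-- A maximum of `(e^{Kφ} - 1) √(1 + |du|²)` with `φ` a barrier plus `α u` bounds the gradient. -/
theorem GraphFlowsByMeanCurvature.gradient_inequality {r : ℝ}
    {u : EuclideanSpace ℝ (Fin n) → ℝ → ℝ} (hu : GraphFlowsByMeanCurvature r u)
    {z : EuclideanSpace ℝ (Fin n) × ℝ} (hz : z ∈ cylinder n r) {p : EuclideanSpace ℝ (Fin n)}
    (hp : ∀ i, p i = dirDeriv (spaceDir i) (spacetime u) z) {K α c β : ℝ} (hK : 0 < K)
    (hc : 0 ≤ c)
    (hpos : 0 < barrier n c r β z + α * spacetime u z)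
    (hmax : ∀ᶠ y in nhds z, y.2 ≤ z.2 →
      (Real.exp (K * (barrier n c r β y + α * spacetime u y)) - 1) * Real.sqrt (areaSq u y) ≤
      (Real.exp (K * (barrier n c r β z + α * spacetime u z)) - 1) * Real.sqrt (areaSq u z)) :
    K * (‖α • p - (2 * c * z.2) • z.1‖ ^ 2 / (1 + ‖p‖ ^ 2)) ≤
      c * (r ^ 2 + 2 * z.2 * n) := by
  have hΩ := isOpen_cylinder (n := n) r
  have hs : ContDiffOn ℝ ∞ (spacetime u) (cylinder n r) := hu.contDiffOn
  have hb : ContDiffOn ℝ ∞ (barrier n c r β) (cylinder n r) := (contDiff_barrier c r β).contDiffOn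
  have hαu : ContDiffOn ℝ ∞ (fun y => α * spacetime u y) (cylinder n r) :=
    contDiffOn_const.mul hs
  have hφ : ContDiffOn ℝ ∞ (fun y => barrier n c r β y + α * spacetime u y) (cylinder n r) :=
    hb.add hαu
  have hη : ContDiffOn ℝ ∞
      (fun y => Real.exp (K * (barrier n c r β y + α * spacetime u y)) - 1) (cylinder n r) :=
    (Real.contDiff_exp.comp_contDiffOn (contDiffOn_const.mul hφ)).sub contDiffOn_const
  have h := hu.frozenHeat_cutoff_nonneg hz hp hη
    (sub_pos.2 (Real.one_lt_exp_iff.2 (mul_pos hK hpos))) hmax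
  rw [frozenHeat_exp hΩ hφ hz] at h
  have h1 := nonneg_of_mul_nonneg_right h (mul_pos hK (Real.exp_pos _))
  have hLu : frozenHeat p (fun y => α * spacetime u y) z = 0 := by
    have := frozenHeat_mul hΩ (f := fun _ => α) contDiffOn_const hs hz p
    have h0 : ∀ w, dirDeriv w (fun _ : EuclideanSpace ℝ (Fin n) × ℝ => α) z = 0 := fun w => by
      simp [dirDeriv]
    rw [this, frozenHeat_const, hu.frozenHeat_self hz hp]
    simp [h0]
  rw [frozenHeat_add hΩ hb hαu hz, hLu, frozenHeat_barrier] at h1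
  set X := α • p - (2 * c * z.2) • z.1 with hX
  have hdir : ∀ w : EuclideanSpace ℝ (Fin n),
      dirDeriv (w, 0) (fun y => barrier n c r β y + α * spacetime u y) z = inner ℝ X w := fun w => by
    have hpw : dirDeriv (w, 0) (spacetime u) z = inner ℝ p w := by
      rw [dirDeriv_space, PiLp.inner_apply]
      exact Finset.sum_congr rfl fun i _ => by simp [hp i]
    rw [dirDeriv_add (differentiableAt_of_smoothOn hΩ hb hz)
      (differentiableAt_of_smoothOn hΩ hαu hz),
      dirDeriv_const_mul (differentiableAt_of_smoothOn hΩ hs hz), dirDeriv_space_barrier, hpw, hX,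
      inner_sub_left, inner_smul_left, inner_smul_left]
    simp
    ring
  have hi : ∀ i, dirDeriv (spaceDir i) (fun y => barrier n c r β y + α * spacetime u y) z = X i :=
    fun i => by
      rw [show dirDeriv (spaceDir i) _ z = _ from hdir (EuclideanSpace.single i 1),
        EuclideanSpace.inner_single_right]
      simp
  rw [hdir p] at h1
  simp only [hi, ← norm_sq_eq_sum] at h1
  have hWpos : 0 < 1 + ‖p‖ ^ 2 := by positivity
  have hcs : inner ℝ X p ^ 2 ≤ ‖X‖ ^ 2 * ‖p‖ ^ 2 := by
    have := abs_real_inner_le_norm X p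
    rw [← mul_pow, ← sq_abs]
    exact pow_le_pow_left₀ (abs_nonneg _) this 2
  -- The inverse metric is bounded below by `1 / (1 + |p|²)`.
  have hlow : ‖X‖ ^ 2 / (1 + ‖p‖ ^ 2) ≤ ‖X‖ ^ 2 - inner ℝ X p ^ 2 / (1 + ‖p‖ ^ 2) := by
    have : ‖X‖ ^ 2 - inner ℝ X p ^ 2 / (1 + ‖p‖ ^ 2) - ‖X‖ ^ 2 / (1 + ‖p‖ ^ 2) =
        (‖X‖ ^ 2 * ‖p‖ ^ 2 - inner ℝ X p ^ 2) / (1 + ‖p‖ ^ 2) := by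
      field_simp
      ring
    have h2 : 0 ≤ (‖X‖ ^ 2 * ‖p‖ ^ 2 - inner ℝ X p ^ 2) / (1 + ‖p‖ ^ 2) :=
      div_nonneg (by linarith) hWpos.le
    linarith
  have hlowK := mul_le_mul_of_nonneg_left hlow hK.le
  have ht : 0 < z.2 := hz.2.1
  have hn1 : 0 ≤ 2 * c * z.2 * (‖p‖ ^ 2 / (1 + ‖p‖ ^ 2)) := by positivity
  have hn2 : 0 ≤ c * ‖z.1‖ ^ 2 := by positivity
  linarith

end Barrier

/-! ### Choice of constants and the final comparison. -/

section Estimate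

variable {n : ℕ}

/-- Here `y = |p|` and `A = r D |dφ|`. The inequality becomes `4 A² ≤ 3 (1 + y²)`; since `4 > 3` it
bounds `y`, and at `y = 17 D` it already fails because `900 D² > 3 + 867 D²`. -/
theorem norm_le_of_scaled_inequality {N D A y : ℝ} (hN : 0 < N) (hD : 1 ≤ D)
    (hA : y - 2 * D ≤ A) (h : 8 * N * (A ^ 2 / (1 + y ^ 2)) ≤ 6 * N) : y ≤ 17 * D := by
  by_contra! hy
  have h1 : 4 * A ^ 2 ≤ 3 * (1 + y ^ 2) := by
    have h2 : 8 * N * A ^ 2 ≤ 6 * N * (1 + y ^ 2) := by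
      rw [← mul_div_assoc, div_le_iff₀ (by positivity)] at h
      exact h
    nlinarith
  have h3 : (y - 2 * D) ^ 2 ≤ A ^ 2 := pow_le_pow_left₀ (by linarith) hA 2
  nlinarith [mul_pos (show 0 < y by linarith) (show 0 < y - 17 * D by linarith)]

theorem sqrt_one_add_sq_le {y : ℝ} (hy : 0 ≤ y) : Real.sqrt (1 + y ^ 2) ≤ 1 + y :=
  Real.sqrt_le_iff.2 ⟨by positivity, by nlinarith⟩

set_option maxHeartbeats 600000 in
/-- The gradient bound, for a flow with `|u| ≤ M`. -/
theorem GraphFlowsByMeanCurvature.sqrt_areaSq_le (hn : 1 ≤ n) {r M : ℝ} (hr : 0 < r)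
    (hM : 0 ≤ M) {u : EuclideanSpace ℝ (Fin n) → ℝ → ℝ} (hu : GraphFlowsByMeanCurvature r u)
    (hb : ∀ x ∈ Metric.ball (0 : EuclideanSpace ℝ (Fin n)) r, ∀ t ∈ Icc 0 (r ^ 2), |u x t| ≤ M) :
    Real.sqrt (areaSq u (0, r ^ 2 / (4 * n))) ≤
      10 * Real.exp (8 * n * (1 + 2 * M / r) ^ 2) := by
  have hs : ContDiffOn ℝ ∞ (spacetime u) (cylinder n r) := hu.contDiffOn
  have hn' : (1 : ℝ) ≤ n := by exact_mod_cast hn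
  have hnpos : (0 : ℝ) < n := by linarith
  set D := 1 + 2 * M / r with hDdef
  have hD : 1 ≤ D := by
    have : 0 ≤ 2 * M / r := by positivity
    linarith
  have hD0 : 0 < D := by linarith
  -- The constants give `c t₀ r² = 1` and `2 α M = 1 - 2 ε`. With `β = α M + ε`, this makes `φ ≥ ε`
  -- at `(0, t₀)` and `φ ≤ 1` on the compact set below. The choice of `K` makes `K ε = 4 n D`, and
  -- `2 K` is the main term of the final bound.
  have hMD : 2 * M = r * (D - 1) := by
    rw [hDdef]
    field_simp
    ring
  set K := 8 * n * D ^ 2 with hKdef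
  have hK : 0 < K := by positivity
  set α := 1 / (r * D) with hα
  have hαpos : 0 < α := by positivity
  set ε := 1 / (2 * D) with hε
  have hε0 : 0 < ε := by positivity
  have hε1 : ε ≤ 1 / 2 := by
    rw [hε]
    exact one_div_le_one_div_of_le (by norm_num) (by linarith)
  have hαM : 2 * (α * M) = 1 - 2 * ε := by
    rw [show 2 * (α * M) = α * (2 * M) by ring, hMD, hα, hε]
    field_simp
  set c := 4 * n / r ^ 4 with hcdef
  have hc : 0 < c := by positivity
  set β := α * M + ε with hβ
  set t₀ := r ^ 2 / (4 * n) with ht₀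
  have ht₀pos : 0 < t₀ := by positivity
  have hct₀ : c * t₀ * r ^ 2 = 1 := by
    rw [hcdef, ht₀]
    field_simp
  have ht₀lt : t₀ < r ^ 2 := by
    rw [ht₀, div_lt_iff₀ (by positivity)]
    nlinarith [sq_pos_of_pos hr]
  set φ : EuclideanSpace ℝ (Fin n) × ℝ → ℝ := fun y => barrier n c r β y + α * spacetime u y
    with hφ
  set F : EuclideanSpace ℝ (Fin n) × ℝ → ℝ := fun y =>
    (Real.exp (K * φ y) - 1) * Real.sqrt (areaSq u y) with hF
  -- This compact subcylinder contains every point of the open cylinder with `t ≤ t₀` and `φ > 0`.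
  set S : Set (EuclideanSpace ℝ (Fin n) × ℝ) :=
    Metric.closedBall 0 (Real.sqrt (1 - ε) * r) ×ˢ Icc (ε * t₀) t₀ with hS
  have hρ : Real.sqrt (1 - ε) * r < r := by
    have : Real.sqrt (1 - ε) < 1 := by
      rw [Real.sqrt_lt' one_pos]
      linarith
    nlinarith
  have hSΩ : S ⊆ cylinder n r := by
    rintro ⟨x, t⟩ ⟨hx, ht⟩
    exact ⟨Metric.closedBall_subset_ball hρ hx,
      lt_of_lt_of_le (mul_pos hε0 ht₀pos) ht.1, lt_of_le_of_lt ht.2 ht₀lt⟩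
  have hSc : IsCompact S := (isCompact_closedBall _ _).prod isCompact_Icc
  have h0S : ((0 : EuclideanSpace ℝ (Fin n)), t₀) ∈ S := by
    refine ⟨Metric.mem_closedBall_self (by positivity), ?_, le_refl _⟩
    change ε * t₀ ≤ t₀
    nlinarith
  have hFc : ContinuousOn F S := by
    have h1 : ContinuousOn φ S := ((contDiff_barrier c r β).continuous.continuousOn).add
      (continuousOn_const.mul (hs.continuousOn.mono hSΩ))
    have h2 : ContinuousOn (areaSq u) S := fun y hy =>
      (dirDeriv_areaSq hs (hSΩ hy) 0).1.continuousAt.continuousWithinAt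
    exact ((Real.continuous_exp.comp_continuousOn (continuousOn_const.mul h1)).sub
      continuousOn_const).mul (Real.continuous_sqrt.comp_continuousOn h2)
  obtain ⟨z, hzS, hzmax⟩ := hSc.exists_isMaxOn ⟨_, h0S⟩ hFc
  have hub : ∀ y ∈ S, α * spacetime u y ≤ α * M ∧ -(α * M) ≤ α * spacetime u y := fun y hy => by
    have hy' := hSΩ hy
    have := abs_le.1 (hb y.1 hy'.1 y.2 (Ioo_subset_Icc_self hy'.2))
    constructor
    · exact mul_le_mul_of_nonneg_left this.2 hαpos.le
    · have := mul_le_mul_of_nonneg_left this.1 hαpos.le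
      rw [mul_neg] at this
      exact this
  have hφ0 : ε ≤ φ (0, t₀) := by
    have := (hub _ h0S).2
    simp only [hφ, barrier, norm_zero]
    have e : c * t₀ * (r ^ 2 - 0 ^ 2) = 1 := by rw [← hct₀]; ring
    rw [e]
    linarith
  have hKε : K * ε = 4 * n * D := by
    rw [hKdef, hε]
    field_simp
    norm_num
  have hη0 : 4 * D ≤ Real.exp (K * φ (0, t₀)) - 1 := by
    have h1 : K * ε ≤ K * φ (0, t₀) := mul_le_mul_of_nonneg_left hφ0 hK.le
    have h2 := Real.add_one_le_exp (K * φ (0, t₀))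
    nlinarith
  have hF0 : F (0, t₀) ≤ F z := hzmax h0S
  have hF0pos : 0 < F (0, t₀) :=
    mul_pos (by linarith) (Real.sqrt_pos.2 (areaSq_pos u _))
  have hηz : 0 < Real.exp (K * φ z) - 1 :=
    pos_of_mul_pos_left (lt_of_lt_of_le hF0pos hF0) (Real.sqrt_nonneg _)
  have hφz : 0 < φ z := by
    have : 0 < K * φ z := Real.one_lt_exp_iff.1 (by linarith)
    exact pos_of_mul_pos_right this hK.le
  have ht₁ : 0 < z.2 := (hSΩ hzS).2.1
  -- As `α u ≤ α M`, positivity of `φ` forces the barrier product above `ε`. This excludes the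
  -- bottom and the lateral side of `S`; only the top `t = t₀` remains possible.
  have hcut : ε < c * z.2 * (r ^ 2 - ‖z.1‖ ^ 2) := by
    have := (hub z hzS).1
    have h2 : 0 < c * z.2 * (r ^ 2 - ‖z.1‖ ^ 2) - β + α * spacetime u z := hφz
    linarith
  have hcr : c * r ^ 2 = 1 / t₀ := by
    field_simp
    linarith
  have hzt : ε * t₀ < z.2 := by
    have h1 : c * z.2 * (r ^ 2 - ‖z.1‖ ^ 2) ≤ c * z.2 * r ^ 2 :=
      mul_le_mul_of_nonneg_left (sub_le_self _ (sq_nonneg _)) (by positivity)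
    have h2 : c * z.2 * r ^ 2 = z.2 / t₀ := by
      rw [mul_right_comm, hcr]
      ring
    rw [← lt_div_iff₀ ht₀pos]
    linarith
  have hzr : ‖z.1‖ < r := by simpa using (hSΩ hzS).1
  have hzr2 : 0 ≤ r ^ 2 - ‖z.1‖ ^ 2 :=
    sub_nonneg.2 (pow_le_pow_left₀ (norm_nonneg _) hzr.le 2)
  have hzx : ‖z.1‖ < Real.sqrt (1 - ε) * r := by
    have h1 := hzr2
    have h2 : c * z.2 * (r ^ 2 - ‖z.1‖ ^ 2) ≤ c * t₀ * (r ^ 2 - ‖z.1‖ ^ 2) :=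
      mul_le_mul_of_nonneg_right (mul_le_mul_of_nonneg_left hzS.2.2 hc.le) h1
    have h3 : ε * r ^ 2 < c * t₀ * r ^ 2 * (r ^ 2 - ‖z.1‖ ^ 2) := by
      have := mul_lt_mul_of_pos_right (hcut.trans_le h2) (sq_pos_of_pos hr)
      linarith
    rw [hct₀, one_mul] at h3
    refine lt_of_pow_lt_pow_left₀ 2 (by positivity) ?_
    rw [mul_pow, Real.sq_sqrt (by linarith)]
    linarith
  have hzmax' : ∀ᶠ y in nhds z, y.2 ≤ z.2 → F y ≤ F z := by
    have h1 : ∀ᶠ y in nhds z, ‖y.1‖ < Real.sqrt (1 - ε) * r :=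
      (continuous_fst.norm.continuousAt (x := z)).eventually_lt_const hzx
    have h2 : ∀ᶠ y in nhds z, ε * t₀ < y.2 :=
      (continuous_snd.continuousAt (x := z)).eventually_const_lt hzt
    filter_upwards [h1, h2] with y hy1 hy2 hy
    exact hzmax ⟨by simpa using hy1.le, hy2.le, hy.trans hzS.2.2⟩
  set p : EuclideanSpace ℝ (Fin n) :=
    WithLp.toLp 2 fun i => dirDeriv (spaceDir i) (spacetime u) z with hp
  have hgrad := hu.gradient_inequality (hSΩ hzS) (p := p) (fun i => rfl) hK hc.le hφz hzmax'
  have hW : areaSq u z = 1 + ‖p‖ ^ 2 := by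
    rw [norm_sq_eq_sum, areaSq]
    simp [hp, sq]
  -- rescale to a bound for `‖p‖`
  have hpD : ‖p‖ ≤ 17 * D := by
    refine norm_le_of_scaled_inequality (N := n) (A := r * D * ‖α • p - (2 * c * z.2) • z.1‖)
      hnpos hD ?_ ?_
    · have h1 : ‖α • p‖ - ‖(2 * c * z.2) • z.1‖ ≤ ‖α • p - (2 * c * z.2) • z.1‖ :=
        norm_sub_norm_le _ _
      rw [norm_smul, norm_smul, Real.norm_of_nonneg hαpos.le,
        Real.norm_of_nonneg (by positivity)] at h1
      have h2 : 2 * c * z.2 * ‖z.1‖ ≤ 2 * c * t₀ * r := by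
        have := hzS.2.2
        gcongr
      have h3 : 2 * c * t₀ * r = 2 / r := by
        field_simp
        linarith
      have h4 : r * D * (α * ‖p‖ - 2 / r) = ‖p‖ - 2 * D := by
        rw [hα]
        field_simp
      rw [← h4]
      exact mul_le_mul_of_nonneg_left (by linarith) (by positivity)
    · have h1 : c * (r ^ 2 + 2 * z.2 * n) ≤ c * (r ^ 2 + 2 * t₀ * n) := by
        have := hzS.2.2
        gcongr
      have h2 : r ^ 2 * (c * (r ^ 2 + 2 * t₀ * n)) = 6 * n := by
        rw [hcdef, ht₀]
        field_simp
        norm_num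
      have h3 := mul_le_mul_of_nonneg_left (hgrad.trans h1) (sq_nonneg r)
      rw [h2] at h3
      refine le_trans (le_of_eq ?_) h3
      rw [hKdef]
      ring
  have hφz1 : φ z ≤ 1 := by
    have h1 := (hub z hzS).1
    have h2 : c * z.2 * (r ^ 2 - ‖z.1‖ ^ 2) ≤ c * t₀ * r ^ 2 := by
      have h4 : r ^ 2 - ‖z.1‖ ^ 2 ≤ r ^ 2 := sub_le_self _ (sq_nonneg _)
      have := hzS.2.2
      gcongr
    have h5 : φ z = c * z.2 * (r ^ 2 - ‖z.1‖ ^ 2) - β + α * spacetime u z := rfl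
    linarith
  have hvz : Real.sqrt (areaSq u z) ≤ 18 * D := by
    rw [hW]
    linarith [sqrt_one_add_sq_le (norm_nonneg p)]
  have hFz : F z ≤ Real.exp K * (18 * D) := by
    have h1 : Real.exp (K * φ z) ≤ Real.exp K := Real.exp_le_exp.2 (mul_le_of_le_one_right hK.le hφz1)
    exact mul_le_mul (by linarith) hvz (Real.sqrt_nonneg _) (Real.exp_pos _).le
  -- The factor `D` cancels and `18 / 4 ≤ 10`.
  have hfin : 4 * D * Real.sqrt (areaSq u (0, t₀)) ≤ Real.exp K * (18 * D) :=
    (mul_le_mul_of_nonneg_right hη0 (Real.sqrt_nonneg _)).trans (hF0.trans hFz)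
  have h1 : D * (4 * Real.sqrt (areaSq u (0, t₀))) ≤ D * (18 * Real.exp K) := by linarith
  have h2 := le_of_mul_le_mul_left h1 hD0
  have := Real.exp_pos K
  linarith

end Estimate

end GraphMCF

/-- Interior gradient estimate for graphs flowing by mean curvature. Both sides are written in
`[0, ∞]`; the real numbers `log (1 + |du|²)`, `2 log 10` and `r` are nonnegative, so that
`ENNReal.ofReal` loses nothing. -/
theorem proposition2p1 (n : ℕ) (hn : 1 ≤ n) (r : ℝ) (hr : 0 < r)
    (u : EuclideanSpace ℝ (Fin n) → ℝ → ℝ)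
    (hu : GraphMCF.GraphFlowsByMeanCurvature r u) :
    ENNReal.ofReal
        (Real.log (1 + ‖gradient (fun x => u x (r ^ 2 / (4 * (n : ℝ)))) 0‖ ^ 2)) ≤
      ENNReal.ofReal (2 * Real.log 10) +
        16 * (n : ℝ≥0∞) * (1 + 2 * (ENNReal.ofReal r)⁻¹ * GraphMCF.supNorm r u) ^ 2 := by
  have hn' : (1 : ℝ) ≤ n := by exact_mod_cast hn
  -- For infinite sup norm the right-hand side is `⊤`, since `n ≠ 0` and `r⁻¹ ≠ 0` in `ℝ≥0∞`.
  by_cases htop : GraphMCF.supNorm r u = ⊤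
  · have h1 : (2 * (ENNReal.ofReal r)⁻¹ : ℝ≥0∞) ≠ 0 :=
      mul_ne_zero two_ne_zero (ENNReal.inv_ne_zero.2 ENNReal.ofReal_ne_top)
    have h2 : (16 * (n : ℝ≥0∞)) ≠ 0 := by
      have : (n : ℝ≥0∞) ≠ 0 := by exact_mod_cast (by omega : n ≠ 0)
      exact mul_ne_zero (by norm_num) this
    rw [htop, ENNReal.mul_top h1, add_top, ENNReal.top_pow two_ne_zero, ENNReal.mul_top h2,
      add_top]
    exact le_top
  set M := (GraphMCF.supNorm r u).toReal with hM
  have hMnn : 0 ≤ M := ENNReal.toReal_nonneg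
  have hb : ∀ x ∈ Metric.ball (0 : EuclideanSpace ℝ (Fin n)) r, ∀ t ∈ Icc 0 (r ^ 2),
      |u x t| ≤ M := fun x hx t ht => by
    have h : ENNReal.ofReal |u x t| ≤ GraphMCF.supNorm r u := by
      unfold GraphMCF.supNorm
      exact le_iSup₂_of_le x hx (le_iSup₂_of_le t ht le_rfl)
    exact (ENNReal.ofReal_le_iff_le_toReal htop).1 h
  have hmain := hu.sqrt_areaSq_le hn hr hMnn hb
  have ht₀ : ((0 : EuclideanSpace ℝ (Fin n)), r ^ 2 / (4 * (n : ℝ))) ∈ GraphMCF.cylinder n r := by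
    refine ⟨Metric.mem_ball_self hr, by positivity, ?_⟩
    change r ^ 2 / (4 * (n : ℝ)) < r ^ 2
    rw [div_lt_iff₀ (by positivity)]
    nlinarith [sq_pos_of_pos hr]
  have hdiff := GraphMCF.differentiableAt_of_smoothOn (f := GraphMCF.spacetime u)
    (GraphMCF.isOpen_cylinder r) hu.contDiffOn ht₀
  rw [GraphMCF.areaSq_eq hdiff]
  have hpos := GraphMCF.areaSq_pos u (0, r ^ 2 / (4 * (n : ℝ)))
  have hlog : Real.log (GraphMCF.areaSq u (0, r ^ 2 / (4 * (n : ℝ)))) ≤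
      2 * Real.log 10 + 16 * n * (1 + 2 * r⁻¹ * M) ^ 2 := by
    -- The logarithm of the square root is half the left-hand side; doubling gives `2 log 10` and
    -- `16 n`.
    have h := Real.log_le_log (Real.sqrt_pos.2 hpos) hmain
    rw [Real.log_sqrt hpos.le, Real.log_mul (by norm_num) (Real.exp_pos _).ne', Real.log_exp] at h
    have e : 1 + 2 * r⁻¹ * M = 1 + 2 * M / r := by ring
    rw [e]
    linarith
  have hrhs : ENNReal.ofReal (2 * Real.log 10) +
      16 * (n : ℝ≥0∞) * (1 + 2 * (ENNReal.ofReal r)⁻¹ * GraphMCF.supNorm r u) ^ 2 =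
      ENNReal.ofReal (2 * Real.log 10 + 16 * n * (1 + 2 * r⁻¹ * M) ^ 2) := by
    have h10 : 0 ≤ Real.log 10 := Real.log_nonneg (by norm_num)
    rw [ENNReal.ofReal_add (by positivity) (by positivity), ENNReal.ofReal_mul (by positivity),
      ENNReal.ofReal_mul (by norm_num), ENNReal.ofReal_pow (by positivity),
      ENNReal.ofReal_add (by norm_num) (by positivity), ENNReal.ofReal_mul (q := M) (by positivity),
      ENNReal.ofReal_mul (p := 2) (by norm_num), ENNReal.ofReal_inv_of_pos hr, hM,
      ENNReal.ofReal_toReal htop]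
    simp
  rw [hrhs]
  exact ENNReal.ofReal_le_ofReal hlog
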